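/- Let $\mathbb{A}_f=\prod_p(\mathbb{Q}_p:\mathbb{Z}_p)$ be the ring of finite adeles of $\mathbb{Q}$ (the restricted product over all primes, with its restricted product topology), $\hat{\mathbb{Z}}=\prod_p\mathbb{Z}_p\subset\mathbb{A}_f$, and embed $\mathbb{Q}$ diagonally in $\mathbb{A}_f$. Let $GL_2^+(\mathbb{Q})=\{g\in GL_2(\mathbb{Q}):\det g>0\}$ and $GL_2^+(\mathbb{A}_f)=\{g\in GL_2(\mathbb{A}_f):\det g\in\mathbb{Q}_+^*\}$, where $GL_2(\mathbb{A}_f)$ has the topology defined by the embedding $g\mapsto(g,\det(g)^{-1})\in M_2(\mathbb{A}_f)\times\mathbb{A}_f$. For $R=\mathbb{Q}$ or $R=\mathbb{A}_f$, let $GL_2^+(R)$ act on the additive group $M_2(R)$ by $\alpha_g(m)=mg^{-1}$, and form $M_2(R)\rtimes GL_2^+(R)$ (with the product topology when $R=\mathbb{A}_f$). A Hecke pair $(N,N_0)$ is a group $N$ with a subgroup $N_0$ such that $[N_0:N_0\cap xN_0x^{-1}]<\infty$ for all $x\in N$; it is reduced if $\bigcap_{x\in N}xN_0x^{-1}=\{e\}$.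 The Schlichting completion of a Hecke pair $(N,N_0)$ is the Hecke pair $(\bar N,\bar N_0)$ together with a homomorphism $\phi\colon N\to\bar N$, characterized uniquely (up to isomorphism) by the properties that $\bar N$ is a locally compact totally disconnected group, $\bar N_0$ is a compact open subgroup of $\bar N$, $(\bar N,\bar N_0)$ is reduced, $\phi(N)$ is dense in $\bar N$, and $\phi^{-1}(\bar N_0)=N_0$. Then the closure of $GL_2^+(\mathbb{Q})$ in $GL_2(\mathbb{A}_f)$ is $GL_2^+(\mathbb{A}_f)$, we have $GL_2^+(\mathbb{A}_f)=GL_2^+(\mathbb{Q})\,SL_2(\hat{\mathbb{Z}})$, and the pair $(M_2(\mathbb{A}_f)\rtimes GL_2^+(\mathbb{A}_f),\ M_2(\hat{\mathbb{Z}})\rtimes SL_2(\hat{\mathbb{Z}}))$, together with the homomorphism induced by the diagonal embedding $\mathbb{Q}\to\mathbb{A}_f$, is the Schlichting completion of the Hecke pair $(M_2(\mathbb{Q})\rtimes GL_2^+(\mathbb{Q}),\ M_2(\mathbb{Z})\rtimes SL_2(\mathbb{Z}))$. -/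

import Mathlib

open scoped RestrictedProduct Pointwise

/-! ### Hecke pairs and Schlichting completions -/

section HeckePairs

/-- `(N, N₀)` is a Hecke pair: `[N₀ : N₀ ∩ x N₀ x⁻¹]` is finite for every `x ∈ N`. -/
def IsHeckePair {N : Type*} [Group N] (N₀ : Subgroup N) : Prop :=
  ∀ x : N, (N₀.map (MulAut.conj x).toMonoidHom).relIndex N₀ ≠ 0

/-- `(N, N₀)` is reduced: the intersection of all conjugates `x N₀ x⁻¹` is trivial. -/
def IsReducedPair {N : Type*} [Group N] (N₀ : Subgroup N) : Prop :=
  ⨅ x : N, N₀.map (MulAut.conj x).toMonoidHom = ⊥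

/-- The pair `(M, M₀)`, together with the homomorphism `φ : N → M`, is the Schlichting completion
of the Hecke pair `(N, N₀)`: `M` is a (Hausdorff) locally compact totally disconnected group,
`M₀` is a compact open subgroup, `(M, M₀)` is a reduced Hecke pair, `φ(N)` is dense in `M`, and
`φ⁻¹(M₀) = N₀`. These properties determine `(M, M₀, φ)` up to a unique isomorphism. -/
structure IsSchlichtingCompletion {N : Type*} [Group N] (N₀ : Subgroup N)
    {M : Type*} [Group M] [TopologicalSpace M] (M₀ : Subgroup M) (φ : N →* M) : Prop where
  isHeckePair : IsHeckePair N₀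
  isTopologicalGroup : IsTopologicalGroup M
  t2Space : T2Space M
  locallyCompactSpace : LocallyCompactSpace M
  totallyDisconnectedSpace : TotallyDisconnectedSpace M
  isCompact : IsCompact (M₀ : Set M)
  isOpen : IsOpen (M₀ : Set M)
  isHeckePair_completion : IsHeckePair M₀
  isReducedPair : IsReducedPair M₀
  denseRange : DenseRange φ
  comap_eq : M₀.comap φ = N₀

end HeckePairs

/-! ### Semidirect products -/

section Semidirect

/-- A semidirect product of topological groups carries the product topology. -/
instance SemidirectProduct.instTopologicalSpaceProd {V G : Type*} [Group V] [Group G]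
    [TopologicalSpace V] [TopologicalSpace G] (φ : G →* MulAut V) :
    TopologicalSpace (V ⋊[φ] G) :=
  TopologicalSpace.induced (fun x => (x.left, x.right)) inferInstance

/-- The subgroup `V₀ ⋊ Γ` of `V ⋊ G`, for subgroups `V₀` of `V` and `Γ` of `G` such that `V₀` is
invariant under `Γ`. -/
def SemidirectProduct.subgroupOfInvariant {V G : Type*} [Group V] [Group G] (φ : G →* MulAut V)
    (V₀ : Subgroup V) (Γ : Subgroup G) (h : ∀ g ∈ Γ, ∀ v ∈ V₀, φ g v ∈ V₀) :
    Subgroup (V ⋊[φ] G) where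
  carrier := {x | x.left ∈ V₀ ∧ x.right ∈ Γ}
  one_mem' := ⟨V₀.one_mem, Γ.one_mem⟩
  mul_mem' := fun {_ _} hx hy =>
    ⟨V₀.mul_mem hx.1 (h _ hx.2 _ hy.1), Γ.mul_mem hx.2 hy.2⟩
  inv_mem' := fun {_} hx =>
    ⟨h _ (Γ.inv_mem hx.2) _ (V₀.inv_mem hx.1), Γ.inv_mem hx.2⟩

end Semidirect

/-! ### Affine groups of `2 × 2` matrices -/

section Affine

/-- The action of `GL₂(R)` by automorphisms of the additive group `M₂(R)` (written
multiplicatively), `α_g(m) = m g⁻¹`. -/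
def matAction (R : Type*) [CommRing R] :
    GL (Fin 2) R →* MulAut (Multiplicative (Matrix (Fin 2) (Fin 2) R)) where
  toFun g :=
    { toFun := fun m => .ofAdd (m.toAdd * (g⁻¹ : GL (Fin 2) R).val)
      invFun := fun m => .ofAdd (m.toAdd * g.val)
      left_inv := fun m => by simp [mul_assoc]
      right_inv := fun m => by simp [mul_assoc]
      map_mul' := fun m n => by simp [add_mul] }
  map_one' := by ext m : 1; simp
  map_mul' g h := by
    ext m : 1
    simp only [MulEquiv.coe_mk, Equiv.coe_fn_mk, MulAut.mul_apply, mul_inv_rev, Units.val_mul,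
      toAdd_ofAdd, mul_assoc]

/-- `M₂(R) ⋊ G` for a subgroup `G` of `GL₂(R)`, with respect to `α_g(m) = m g⁻¹`. -/
abbrev AffineMatGroup (R : Type*) [CommRing R] (G : Subgroup (GL (Fin 2) R)) : Type _ :=
  Multiplicative (Matrix (Fin 2) (Fin 2) R) ⋊[(matAction R).comp G.subtype] G

/-- The additive subgroup `M₂(O)` of `M₂(R)` (more precisely its image), for an `O`-algebra `R`. -/
def matSubgroup (O R : Type*) [CommRing O] [CommRing R] [Algebra O R] :
    AddSubgroup (Matrix (Fin 2) (Fin 2) R) :=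
  ((algebraMap O R).mapMatrix : Matrix (Fin 2) (Fin 2) O →+* _).range.toAddSubgroup

/-- The subgroup `SL₂(O)` of `GL₂(R)` (more precisely its image), for an `O`-algebra `R`. -/
def slSubgroup (O R : Type*) [CommRing O] [CommRing R] [Algebra O R] :
    Subgroup (GL (Fin 2) R) :=
  (Matrix.SpecialLinearGroup.mapGL R : Matrix.SpecialLinearGroup (Fin 2) O →* _).range

/-- The subgroup `M₂(O) ⋊ SL₂(O)` of `M₂(R) ⋊ G`; of `SL₂(O)` only the elements of `G` are taken,
which is no restriction in the cases of interest, where `SL₂(O) ≤ G`. -/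
def affineSubgroup (O R : Type*) [CommRing O] [CommRing R] [Algebra O R]
    (G : Subgroup (GL (Fin 2) R)) : Subgroup (AffineMatGroup R G) :=
  SemidirectProduct.subgroupOfInvariant _
    (AddSubgroup.toSubgroup (matSubgroup O R)) ((slSubgroup O R).subgroupOf G) (by
      intro g hg v hv
      obtain ⟨s, hs⟩ := Subgroup.inv_mem _ (Subgroup.mem_subgroupOf.1 hg)
      obtain ⟨m, hm⟩ : ∃ m : Matrix (Fin 2) (Fin 2) O,
        (algebraMap O R).mapMatrix m = v.toAdd := hv
      refine (⟨m * s.val, ?_⟩ : ∃ m : Matrix (Fin 2) (Fin 2) O, (algebraMap O R).mapMatrix m =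
        v.toAdd * ((g : GL (Fin 2) R)⁻¹).val)
      rw [map_mul, hm, ← hs]
      rfl)

/-- The homomorphism `M₂(R) ⋊ G → M₂(S) ⋊ H` induced by a ring homomorphism `f : R → S` which
maps `G` into `H`. -/
def affineMap {R S : Type*} [CommRing R] [CommRing S] (f : R →+* S)
    (G : Subgroup (GL (Fin 2) R)) (H : Subgroup (GL (Fin 2) S))
    (h : G ≤ H.comap (Matrix.GeneralLinearGroup.map f)) :
    AffineMatGroup R G →* AffineMatGroup S H :=
  SemidirectProduct.map (AddMonoidHom.toMultiplicative f.mapMatrix.toAddMonoidHom)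
    (((Matrix.GeneralLinearGroup.map f).comp G.subtype).codRestrict H fun g => h g.2) (by
      intro g
      refine MonoidHom.ext fun m => congrArg Multiplicative.ofAdd ?_
      change f.mapMatrix (m.toAdd * ((g : GL (Fin 2) R)⁻¹).val) =
        f.mapMatrix m.toAdd * ((Matrix.GeneralLinearGroup.map f (g : GL (Fin 2) R))⁻¹).val
      rw [map_mul, ← map_inv]
      rfl)

end Affine

/-! ### Finite adeles of the rationals -/

section Adeles

instance Nat.Primes.instFactPrime (p : Nat.Primes) : Fact (p : ℕ).Prime := ⟨p.2⟩

/-- The ring `𝔸_f` of finite adeles of `ℚ`: the restricted product of the fields `ℚ_p` with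
respect to the subrings `ℤ_p`, over all primes `p`, with the restricted product topology. -/
abbrev FinAdeles : Type :=
  Πʳ p : Nat.Primes, [ℚ_[(p : ℕ)], PadicInt.subring (p : ℕ)]

/-- The subring `Ẑ = ∏ₚ ℤ_p` of `𝔸_f`. -/
noncomputable def zHat : Subring FinAdeles where
  carrier := {x | ∀ p : Nat.Primes, x p ∈ PadicInt.subring (p : ℕ)}
  zero_mem' := fun _ => zero_mem _
  one_mem' := fun _ => one_mem _
  add_mem' := fun {_ _} hx hy p => add_mem (hx p) (hy p)
  mul_mem' := fun {_ _} hx hy p => mul_mem (hx p) (hy p)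
  neg_mem' := fun {_} hx p => neg_mem (hx p)

/-- The diagonal embedding of `ℚ` into `𝔸_f`. -/
noncomputable def ratToFinAdeles : ℚ →+* FinAdeles where
  toFun q := ⟨fun p => (q : ℚ_[(p : ℕ)]), by
    have hf : {p : Nat.Primes | (p : ℕ) ∣ q.den}.Finite :=
      ((Set.finite_Iic q.den).subset fun _ h => Nat.le_of_dvd q.den_pos h).preimage
        (s := {n : ℕ | n ∣ q.den}) Nat.Primes.coe_nat_injective.injOn
    refine Filter.eventually_cofinite.2 (hf.subset fun p hp => ?_)
    by_contra hd
    exact hp (Padic.norm_rat_le_one hd)⟩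
  map_one' := RestrictedProduct.ext _ _ fun _ => Rat.cast_one
  map_mul' x y := RestrictedProduct.ext _ _ fun _ => Rat.cast_mul x y
  map_zero' := RestrictedProduct.ext _ _ fun _ => Rat.cast_zero
  map_add' x y := RestrictedProduct.ext _ _ fun _ => Rat.cast_add x y

/-- `GL₂⁺(𝔸_f) = {g ∈ GL₂(𝔸_f) | det g ∈ ℚ₊^*}`, where `ℚ₊^*` is the group of positive rationals,
diagonally embedded. -/
noncomputable def glPosFinAdeles : Subgroup (GL (Fin 2) FinAdeles) :=
  ((Units.posSubgroup ℚ).map (Units.map ratToFinAdeles.toMonoidHom)).comap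
    Matrix.GeneralLinearGroup.det

/-- The diagonal embedding `GL₂(ℚ) → GL₂(𝔸_f)`. -/
noncomputable abbrev glRatToFinAdeles : GL (Fin 2) ℚ →* GL (Fin 2) FinAdeles :=
  Matrix.GeneralLinearGroup.map ratToFinAdeles

/-- The diagonal embedding maps `GL₂⁺(ℚ)` into `GL₂⁺(𝔸_f)`. -/
theorem glPos_le_comap : Matrix.GLPos (Fin 2) ℚ ≤ glPosFinAdeles.comap glRatToFinAdeles := by
  intro g hg
  exact ⟨Matrix.GeneralLinearGroup.det g, hg, Units.ext (RingHom.map_det ratToFinAdeles g.val)⟩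

end Adeles

open Topology

/-! The first two claims are strong approximation. By the Chinese remainder theorem ℚ is dense in
𝔸_f (`denseRange_ratToFinAdeles`), so the closure of GL₂⁺(ℚ) contains all adelic unipotents. These
generate SL₂(𝔸_f) (`mem_of_isUnit_of_unipotent_mem`, `FinAdeles.exists_isUnit_add_mul`), and the
matrices diag(q, 1) account for the remaining determinants. Conversely GL₂⁺(𝔸_f) is closed, since
ℚ₊^* is discrete in the ideles.

Because ℚ₊^* meets Ẑ^* only in 1, the open set GL₂(Ẑ) meets GL₂⁺(𝔸_f) exactly in SL₂(Ẑ)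
(`mem_slSubgroup_zHat_iff_of_mem`). Hence SL₂(Ẑ) is open in GL₂⁺(𝔸_f), and density gives the product
decomposition.

For the completion, M₂(Ẑ) ⋊ SL₂(Ẑ) is compact and open, which gives local compactness and both Hecke
conditions. Density holds factor by factor, the preimage is computed from ℚ ∩ Ẑ = ℤ, and the pair is
reduced because no nonzero adele has all its rational multiples in Ẑ. -/

/-! ### Finite adeles: Ẑ is compact open, ℚ ∩ Ẑ = ℤ, and ℚ is dense. -/

instance PadicInt.fact_isOpen_subring :
    Fact (∀ p : Nat.Primes, IsOpen (PadicInt.subring (p : ℕ) : Set ℚ_[(p : ℕ)])) := by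
  refine ⟨fun p => ?_⟩
  have : (PadicInt.subring (p : ℕ) : Set ℚ_[(p : ℕ)]) = Metric.closedBall 0 1 := by
    ext x; simp
  rw [this]
  exact IsUltrametricDist.isOpen_closedBall _ one_ne_zero

instance PadicInt.compactSpace_subring (p : Nat.Primes) :
    CompactSpace (PadicInt.subring (p : ℕ)) :=
  inferInstanceAs (CompactSpace ℤ_[(p : ℕ)])

theorem mem_zHat {x : FinAdeles} : x ∈ zHat ↔ ∀ p : Nat.Primes, ‖x p‖ ≤ 1 := Iff.rfl

theorem zHat_eq_range_structureMap :
    (zHat : Set FinAdeles) = Set.range (RestrictedProduct.structureMap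
      (fun p : Nat.Primes => ℚ_[(p : ℕ)])
      (fun p => (PadicInt.subring (p : ℕ) : Set ℚ_[(p : ℕ)])) Filter.cofinite) := by
  ext x
  exact ⟨fun hx => ⟨fun p => ⟨x p, hx p⟩, rfl⟩, by rintro ⟨y, rfl⟩ p; exact (y p).2⟩

theorem isOpen_zHat : IsOpen (zHat : Set FinAdeles) :=
  RestrictedProduct.isOpen_forall_mem PadicInt.fact_isOpen_subring.out

theorem isCompact_zHat : IsCompact (zHat : Set FinAdeles) := by
  rw [zHat_eq_range_structureMap]
  have (p : Nat.Primes) : CompactSpace (PadicInt.subring (p : ℕ) : Set ℚ_[(p : ℕ)]) :=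
    PadicInt.compactSpace_subring p
  exact isCompact_range RestrictedProduct.isEmbedding_structureMap.continuous

@[simp]
theorem ratToFinAdeles_apply (q : ℚ) (p : Nat.Primes) : ratToFinAdeles q p = q := rfl

theorem ratToFinAdeles_injective : Function.Injective ratToFinAdeles := fun a b h => by
  have := congrArg (fun x : FinAdeles => x ⟨2, Nat.prime_two⟩) h
  exact Rat.cast_injective this

/-- A prime dividing the denominator of a p-integral q would also divide q.num = q * q.den, against
coprimality. -/
theorem Rat.den_eq_one_of_forall_padic_norm_le_one {q : ℚ}
    (h : ∀ p : Nat.Primes, ‖(q : ℚ_[(p : ℕ)])‖ ≤ 1) : q.den = 1 := by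
  by_contra hd
  obtain ⟨p, hp, hpd⟩ := Nat.exists_prime_and_dvd hd
  have : Fact p.Prime := ⟨hp⟩
  have h1 : ‖(q : ℚ_[p])‖ ≤ 1 := h ⟨p, hp⟩
  have hden : ‖(q.den : ℚ_[p])‖ < 1 :=
    Padic.norm_natCast_lt_one_iff.2 hpd
  have hnum : ‖(q.num : ℚ_[p])‖ < 1 := by
    have : (q.num : ℚ_[p]) = q * q.den := by
      exact_mod_cast congrArg (Rat.cast : ℚ → ℚ_[p]) (Rat.mul_den_eq_num q).symm
    rw [this, norm_mul]
    exact mul_lt_one_of_nonneg_of_lt_one_right h1 (norm_nonneg _) hden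
  have := Int.natCast_dvd.1 (Padic.norm_intCast_lt_one_iff.1 hnum)
  exact hp.ne_one (Nat.eq_one_of_dvd_coprimes q.reduced this hpd)

theorem ratToFinAdeles_mem_zHat {q : ℚ} : ratToFinAdeles q ∈ zHat ↔ ∃ n : ℤ, (n : ℚ) = q := by
  refine ⟨fun h => ⟨q.num, ?_⟩, ?_⟩
  · exact Rat.coe_int_num_of_den_eq_one (Rat.den_eq_one_of_forall_padic_norm_le_one h)
  · rintro ⟨n, rfl⟩ p
    rw [ratToFinAdeles_apply, Rat.cast_intCast]
    exact Padic.norm_int_le_one n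

theorem Padic.exists_natCast_modEq_norm_sub_lt {p : ℕ} [Fact p.Prime] {y : ℚ_[p]} (hy : ‖y‖ ≤ 1)
    {ε : ℝ} (hε : 0 < ε) :
    ∃ a N : ℕ, ∀ m : ℕ, m ≡ a [MOD p ^ N] → ‖(m : ℚ_[p]) - y‖ < ε := by
  obtain ⟨N, hN⟩ := PadicInt.exists_pow_neg_lt p hε
  refine ⟨PadicInt.appr ⟨y, hy⟩ N, N, fun m hm => ?_⟩
  have h1 : ‖y - (PadicInt.appr ⟨y, hy⟩ N : ℕ)‖ ≤ (p : ℝ) ^ (-N : ℤ) :=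
    (PadicInt.norm_le_pow_iff_mem_span_pow _ N).2 (PadicInt.appr_spec N ⟨y, hy⟩)
  have h2 : ‖(m : ℚ_[p]) - (PadicInt.appr ⟨y, hy⟩ N : ℕ)‖ ≤ (p : ℝ) ^ (-N : ℤ) := by
    have := (Padic.norm_int_le_pow_iff_dvd (p := p) ((m : ℤ) - (PadicInt.appr ⟨y, hy⟩ N : ℕ)) N).2
      (by exact_mod_cast (Nat.modEq_iff_dvd.1 hm.symm))
    simpa using this
  rw [← dist_eq_norm] at h1 h2 ⊢
  exact ((dist_triangle_max _ _ _).trans (max_le h2 (by rwa [dist_comm]))).trans_lt hN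

theorem zHat_subset_closure_range_natCast :
    (zHat : Set FinAdeles) ⊆ closure (Set.range fun n : ℕ => ratToFinAdeles n) := by
  rw [zHat_eq_range_structureMap]
  rintro _ ⟨y, rfl⟩
  let i : ℕ → ∀ p : Nat.Primes, (PadicInt.subring (p : ℕ) : Set ℚ_[(p : ℕ)]) :=
    fun n p => ⟨n, by simp⟩
  -- The structure map is continuous, so it is enough to approximate in ∏ ℤ_p with the product
  -- topology. There a neighbourhood constrains only finitely many primes, and the Chinese remainder
  -- theorem applies.
  suffices y ∈ closure (Set.range i) by
    refine closure_mono ?_ (image_closure_subset_closure_image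
      RestrictedProduct.isEmbedding_structureMap.continuous (Set.mem_image_of_mem _ this))
    rintro _ ⟨_, ⟨n, rfl⟩, rfl⟩
    exact ⟨n, RestrictedProduct.ext _ _ fun p => Rat.cast_natCast n⟩
  refine mem_closure_iff.2 fun U hU hyU => ?_
  obtain ⟨I, u, hu, hIU⟩ := isOpen_pi_iff.1 hU y hyU
  have key : ∀ p : Nat.Primes, ∃ a N : ℕ, p ∈ I → ∀ m : ℕ, m ≡ a [MOD (p : ℕ) ^ N] →
      i m p ∈ u p := by
    intro p
    by_cases hp : p ∈ I
    · obtain ⟨ε, hε, hb⟩ := Metric.isOpen_iff.1 (hu p hp).1 (y p) (hu p hp).2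
      obtain ⟨a, N, h⟩ := Padic.exists_natCast_modEq_norm_sub_lt (y p).2 hε
      refine ⟨a, N, fun _ m hm => hb ?_⟩
      rw [Metric.mem_ball, Subtype.dist_eq, dist_eq_norm]
      exact h m hm
    · exact ⟨0, 0, fun h => absurd h hp⟩
  choose a N h using key
  obtain ⟨k, hk⟩ := Nat.chineseRemainderOfFinset a (fun p : Nat.Primes => (p : ℕ) ^ N p) I
    (fun p _ => pow_ne_zero _ p.2.ne_zero) (fun p _ q _ hpq =>
      Nat.Coprime.pow _ _ ((Nat.coprime_primes p.2 q.2).2 fun h => hpq (Subtype.ext h)))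
  exact ⟨i k, hIU fun p hp => h p hp k (hk p hp), k, rfl⟩

theorem FinAdeles.exists_natCast_mul_mem_zHat (x : FinAdeles) :
    ∃ n : ℕ, n ≠ 0 ∧ ratToFinAdeles n * x ∈ zHat := by
  have hx : {p : Nat.Primes | ¬ ‖x p‖ ≤ 1}.Finite := x.2
  have key : ∀ p : Nat.Primes, ∃ k : ℕ, ‖((p : ℕ) : ℚ_[(p : ℕ)]) ^ k * x p‖ ≤ 1 := by
    intro p
    obtain ⟨k, hk⟩ := pow_unbounded_of_one_lt ‖x p‖
      (show (1 : ℝ) < (p : ℕ) by exact_mod_cast p.2.one_lt)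
    refine ⟨k, ?_⟩
    have : (0 : ℝ) < (p : ℕ) := by exact_mod_cast p.2.pos
    rw [norm_mul, norm_pow, Padic.norm_p, inv_pow, inv_mul_le_one₀ (by positivity)]
    exact hk.le
  choose k hk using key
  -- At a bad prime its own factor clears the denominator; all other factors are integers, of norm
  -- at most 1.
  refine ⟨∏ p ∈ hx.toFinset, (p : ℕ) ^ k p,
    Finset.prod_ne_zero_iff.2 fun p _ => pow_ne_zero _ p.2.ne_zero, fun q => ?_⟩
  change ‖((↑(∏ p ∈ hx.toFinset, (p : ℕ) ^ k p : ℕ) : ℚ) : ℚ_[(q : ℕ)]) * x q‖ ≤ 1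
  rw [Rat.cast_natCast]
  have hnat (n : ℕ) : ‖(n : ℚ_[(q : ℕ)])‖ ≤ 1 := by simpa using Padic.norm_int_le_one (p := q) n
  by_cases hq : ‖x q‖ ≤ 1
  · rw [norm_mul]
    exact mul_le_one₀ (hnat _) (norm_nonneg _) hq
  · rw [← Finset.prod_erase_mul _ _ (hx.mem_toFinset.2 hq), Nat.cast_mul, mul_assoc, norm_mul]
    refine mul_le_one₀ (hnat _) (norm_nonneg _) ?_
    rw [Nat.cast_pow]
    exact hk q

/-- Clearing denominators puts n * x in Ẑ, where the naturals are dense; multiplication by n⁻¹ is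
continuous and preserves ℚ. -/
theorem denseRange_ratToFinAdeles : DenseRange ratToFinAdeles := by
  intro x
  obtain ⟨n, hn, hx⟩ := x.exists_natCast_mul_mem_zHat
  have hcont : Continuous fun z : FinAdeles => ratToFinAdeles (n : ℚ)⁻¹ * z := by fun_prop
  have := image_closure_subset_closure_image hcont
    (Set.mem_image_of_mem _ (zHat_subset_closure_range_natCast hx))
  rw [← mul_assoc, ← map_mul, inv_mul_cancel₀ (by exact_mod_cast hn), map_one, one_mul] at this
  refine closure_mono ?_ this
  rintro _ ⟨_, ⟨m, rfl⟩, rfl⟩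
  exact ⟨_, map_mul _ _ _⟩

/-- If x p ≠ 0, then q = p⁻ᵏ with k large makes the p-component of q * x non-integral. Reducedness
of the adelic pair rests on this. -/
theorem FinAdeles.eq_zero_of_forall_mul_mem_zHat {x : FinAdeles}
    (h : ∀ q : ℚ, ratToFinAdeles q * x ∈ zHat) : x = 0 := by
  refine RestrictedProduct.ext _ _ fun p => ?_
  by_contra hx
  have hpos : 0 < ‖x p‖ := norm_pos_iff.2 hx
  obtain ⟨k, hk⟩ := pow_unbounded_of_one_lt ‖x p‖⁻¹
      (show (1 : ℝ) < (p : ℕ) by exact_mod_cast p.2.one_lt)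
  have h1 : ‖(((((p : ℕ) : ℚ) ^ k)⁻¹ : ℚ) : ℚ_[(p : ℕ)]) * x p‖ ≤ 1 := h _ p
  push_cast at h1
  rw [norm_mul, norm_inv, norm_pow, Padic.norm_p, inv_pow, inv_inv] at h1
  have := (inv_lt_iff_one_lt_mul₀ hpos).1 hk
  linarith

/-! ### Unipotent factorization of matrices of determinant 1. -/

namespace Matrix.GeneralLinearGroup

section

variable {R S : Type*} [CommRing R] [CommRing S]

/-- The upper unipotent matrix with upper right entry `x`. -/
def upperUnipotent (x : R) : GL (Fin 2) R :=
  SpecialLinearGroup.toGL ⟨!![1, x; 0, 1], by simp [det_fin_two]⟩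

/-- The lower unipotent matrix with lower left entry `x`. -/
def lowerUnipotent (x : R) : GL (Fin 2) R :=
  SpecialLinearGroup.toGL ⟨!![1, 0; x, 1], by simp [det_fin_two]⟩

theorem coe_upperUnipotent (x : R) : (upperUnipotent x).val = !![1, x; 0, 1] := rfl

theorem coe_lowerUnipotent (x : R) : (lowerUnipotent x).val = !![1, 0; x, 1] := rfl

theorem map_upperUnipotent (f : R →+* S) (x : R) :
    map f (upperUnipotent x) = upperUnipotent (f x) := by
  refine Units.ext ?_
  change f.mapMatrix (upperUnipotent x).val = _
  ext i j
  fin_cases i <;> fin_cases j <;> simp [coe_upperUnipotent]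

theorem map_lowerUnipotent (f : R →+* S) (x : R) :
    map f (lowerUnipotent x) = lowerUnipotent (f x) := by
  refine Units.ext ?_
  change f.mapMatrix (lowerUnipotent x).val = _
  ext i j
  fin_cases i <;> fin_cases j <;> simp [coe_lowerUnipotent]

theorem det_map_eq (f : R →+* S) (g : GL (Fin 2) R) : (map f g).val.det = f g.val.det :=
  (RingHom.map_det f g.val).symm

theorem det_inv_mul_eq_one {g h : GL (Fin 2) R} (e : h.val.det = g.val.det) :
    (h⁻¹ * g).val.det = 1 := by
  have : GeneralLinearGroup.det (h⁻¹ * g) = 1 := by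
    rw [map_mul, map_inv, inv_mul_eq_one]
    exact Units.ext e
  exact congrArg Units.val this

/-- Left multiplication by the lower unipotent of t turns the lower left entry into u = c + t * a.
Once u is a unit, the upper unipotents on either side of the lower unipotent of u can be solved for
the two diagonal entries, and the determinant forces the last entry. -/
theorem mem_of_isUnit_of_unipotent_mem {H : Subgroup (GL (Fin 2) R)}
    (hu : ∀ x, upperUnipotent x ∈ H) (hl : ∀ x, lowerUnipotent x ∈ H) {g : GL (Fin 2) R}
    (hg : g.val.det = 1) {t : R} (ht : IsUnit (g.val 1 0 + t * g.val 0 0)) : g ∈ H := by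
  obtain ⟨v, hv⟩ := isUnit_iff_exists_inv.1 ht
  rw [det_fin_two] at hg
  suffices g = lowerUnipotent (-t) * upperUnipotent ((g.val 0 0 - 1) * v) *
      lowerUnipotent (g.val 1 0 + t * g.val 0 0) *
      upperUnipotent ((g.val 1 1 + t * g.val 0 1 - 1) * v) by
    rw [this]
    exact H.mul_mem (H.mul_mem (H.mul_mem (hl _) (hu _)) (hl _)) (hu _)
  refine Units.ext ?_
  simp only [Units.val_mul, coe_upperUnipotent, coe_lowerUnipotent]
  rw [eta_fin_two g.val]
  generalize g.val 0 0 = a, g.val 0 1 = b, g.val 1 0 = c, g.val 1 1 = d at *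
  ext i j
  fin_cases i <;> fin_cases j <;> simp [mul_apply, Fin.sum_univ_two]
  · linear_combination (1 - a) * hv
  · linear_combination (-(b + (a - 1) * ((d + t * b - 1) * v))) * hv - v * hg
  · linear_combination t * (a - 1) * hv
  · linear_combination (t * (b + (a - 1) * ((d + t * b - 1) * v)) - (d + t * b - 1)) * hv +
      t * v * hg

end

section

variable {R : Type*} [CommRing R] [TopologicalSpace R] [IsTopologicalRing R]

theorem continuous_upperUnipotent : Continuous (upperUnipotent : R → GL (Fin 2) R) :=
  SpecialLinearGroup.continuous_toGL.comp <| Continuous.subtype_mk (by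
    refine continuous_matrix fun i j => ?_
    fin_cases i <;> fin_cases j <;> simp <;> fun_prop) _

theorem continuous_lowerUnipotent : Continuous (lowerUnipotent : R → GL (Fin 2) R) :=
  SpecialLinearGroup.continuous_toGL.comp <| Continuous.subtype_mk (by
    refine continuous_matrix fun i j => ?_
    fin_cases i <;> fin_cases j <;> simp <;> fun_prop) _

end

end Matrix.GeneralLinearGroup

/-! ### Making the lower left entry an adelic unit. -/

/-- The choice t = 0 or t = 1 always suffices. For integral entries with c not a unit, a * d = 1 + b
* c is a unit, hence so are a and c + a. Otherwise only c + t * a ≠ 0 is needed, and a, c cannot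
both vanish. -/
theorem Padic.exists_norm_add_mul_eq_one {p : ℕ} [Fact p.Prime] {a b c d : ℚ_[p]}
    (h : a * d - b * c = 1) :
    ∃ t : ℚ_[p], ‖t‖ ≤ 1 ∧ c + t * a ≠ 0 ∧
      (‖a‖ ≤ 1 → ‖b‖ ≤ 1 → ‖c‖ ≤ 1 → ‖d‖ ≤ 1 → ‖c + t * a‖ = 1) := by
  by_cases hc1 : ‖c‖ = 1
  · refine ⟨0, by simp, ?_, fun _ _ _ _ => by simpa using hc1⟩
    rintro h0
    simp [(by simpa using h0 : c = 0)] at hc1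
  by_cases hi : ‖a‖ ≤ 1 ∧ ‖b‖ ≤ 1 ∧ ‖c‖ ≤ 1 ∧ ‖d‖ ≤ 1
  · obtain ⟨ha, hb, hc, hd⟩ := hi
    have hc : ‖c‖ < 1 := lt_of_le_of_ne hc hc1
    have hbc : ‖b * c‖ < 1 := by
      rw [norm_mul]; exact mul_lt_one_of_nonneg_of_lt_one_right hb (norm_nonneg _) hc
    have ha1 : ‖a‖ = 1 := by
      by_contra hne
      have had : ‖a * d‖ < 1 := by
        rw [norm_mul]
        exact mul_lt_one_of_nonneg_of_lt_one_left (norm_nonneg _) (lt_of_le_of_ne ha hne) hd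
      have := dist_triangle_max (a * d) 0 (b * c)
      rw [dist_eq_norm, h, norm_one, dist_zero_right, dist_zero_left] at this
      exact absurd this (not_le.2 (max_lt had hbc))
    have hs : ‖c + 1 * a‖ = 1 := by
      rw [one_mul, IsUltrametricDist.norm_add_eq_max_of_norm_ne_norm (by rw [ha1]; exact hc.ne), ha1,
        max_eq_right hc.le]
    exact ⟨1, by simp, fun h0 =>
      zero_ne_one (by rwa [h0, norm_zero] at hs), fun _ _ _ _ => hs⟩
  · by_cases hc : c = 0
    · refine ⟨1, by simp, ?_, fun ha hb hc hd => absurd ⟨ha, hb, hc, hd⟩ hi⟩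
      rintro h0
      simp [hc] at h0
      simp [hc, h0] at h
    · exact ⟨0, by simp, by simpa using hc, fun ha hb hc hd => absurd ⟨ha, hb, hc, hd⟩ hi⟩

theorem FinAdeles.exists_isUnit_add_mul {a b c d : FinAdeles} (h : a * d - b * c = 1) :
    ∃ t : FinAdeles, IsUnit (c + t * a) := by
  have hp (p : Nat.Primes) := Padic.exists_norm_add_mul_eq_one
    (congrArg (fun x : FinAdeles => x p) h : a p * d p - b p * c p = 1)
  choose t ht1 ht0 ht using hp
  refine ⟨⟨t, Filter.Eventually.of_forall ht1⟩, isUnit_iff_exists_inv.2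
    ⟨⟨fun p => (c p + t p * a p)⁻¹, ?_⟩, RestrictedProduct.ext _ _ fun p =>
      mul_inv_cancel₀ (ht0 p)⟩⟩
  -- All four entries are integral at almost every p, where c + t * a then has norm 1; so the
  -- componentwise inverse is again a finite adele.
  filter_upwards [a.2, b.2, c.2, d.2] with p ha hb hc hd
  change ‖(c p + t p * a p)⁻¹‖ ≤ 1
  rw [norm_inv, ht p ha hb hc hd, inv_one]

/-! ### Positive rational determinants and integral matrices. -/

theorem mem_glPosFinAdeles {g : GL (Fin 2) FinAdeles} :
    g ∈ glPosFinAdeles ↔ ∃ q : ℚ, 0 < q ∧ ratToFinAdeles q = g.val.det := by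
  constructor
  · rintro ⟨q, hq, h⟩
    exact ⟨q, hq, congrArg Units.val h⟩
  · rintro ⟨q, hq, h⟩
    exact ⟨Units.mk0 q hq.ne', hq, Units.ext h⟩

theorem glRatToFinAdeles_mem_glPosFinAdeles {g : GL (Fin 2) ℚ} (hg : g ∈ Matrix.GLPos (Fin 2) ℚ) :
    glRatToFinAdeles g ∈ glPosFinAdeles := glPos_le_comap hg

theorem eq_one_of_ratToFinAdeles_mem_zHat {q : ℚ} (hq : 0 < q) (h : ratToFinAdeles q ∈ zHat)
    (h' : ratToFinAdeles q⁻¹ ∈ zHat) : q = 1 := by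
  obtain ⟨m, rfl⟩ := ratToFinAdeles_mem_zHat.1 h
  obtain ⟨n, hn⟩ := ratToFinAdeles_mem_zHat.1 h'
  have h1 : m * n = 1 := by
    have : (m : ℚ) * n = 1 := by rw [hn, mul_inv_cancel₀ hq.ne']
    exact_mod_cast this
  have hm : 0 < m := by exact_mod_cast hq
  rw [Int.eq_one_of_mul_eq_one_right hm.le h1, Int.cast_one]

theorem Matrix.det_mem_of_forall_mem {R : Type*} [CommRing R] {S : Subring R}
    {m : Matrix (Fin 2) (Fin 2) R} (h : ∀ i j, m i j ∈ S) : m.det ∈ S := by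
  rw [det_fin_two]
  exact S.sub_mem (S.mul_mem (h _ _) (h _ _)) (S.mul_mem (h _ _) (h _ _))

theorem det_eq_one_of_mem_zHat {g : GL (Fin 2) FinAdeles} (hg : g ∈ glPosFinAdeles)
    (h : g.val.det ∈ zHat) (h' : g⁻¹.val.det ∈ zHat) :
    g.val.det = 1 := by
  obtain ⟨q, hq, hd⟩ := mem_glPosFinAdeles.1 hg
  have hinv : g⁻¹.val.det = ratToFinAdeles q⁻¹ := by
    have h1 : g.val.det * g⁻¹.val.det = 1 := by
      rw [← Matrix.det_mul, ← Units.val_mul, mul_inv_cancel, Units.val_one, Matrix.det_one]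
    have h2 : ratToFinAdeles q⁻¹ * g.val.det = 1 := by
      rw [← hd, ← map_mul, inv_mul_cancel₀ hq.ne', map_one]
    rw [← one_mul g⁻¹.val.det, ← h2, mul_assoc, h1, mul_one]
  rw [← hd] at h ⊢
  rw [hinv] at h'
  rw [eq_one_of_ratToFinAdeles_mem_zHat hq h h', map_one]

section

variable {O R : Type*} [CommRing O] [CommRing R] [Algebra O R]

theorem mem_matSubgroup {m : Matrix (Fin 2) (Fin 2) R} :
    m ∈ matSubgroup O R ↔ ∀ i j, m i j ∈ (algebraMap O R).range := by
  constructor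
  · rintro ⟨n, rfl⟩ i j
    exact ⟨n i j, rfl⟩
  · intro h
    choose n hn using h
    exact ⟨Matrix.of n, Matrix.ext hn⟩

/-- Injectivity is what lets determinant 1 over R descend to the lift over O. -/
theorem mem_slSubgroup (hinj : Function.Injective (algebraMap O R)) {g : GL (Fin 2) R} :
    g ∈ slSubgroup O R ↔ g.val ∈ matSubgroup O R ∧ g.val.det = 1 := by
  constructor
  · rintro ⟨s, rfl⟩
    refine ⟨⟨s.val, rfl⟩, ?_⟩
    change ((algebraMap O R).mapMatrix s.val).det = 1
    rw [← RingHom.map_det, s.2, map_one]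
  · rintro ⟨⟨n, hn⟩, hd⟩
    refine ⟨⟨n, hinj ?_⟩, Units.ext hn⟩
    rw [RingHom.map_det, map_one, ← hd]
    exact congrArg Matrix.det hn

end

theorem mem_matSubgroup_zHat {m : Matrix (Fin 2) (Fin 2) FinAdeles} :
    m ∈ matSubgroup zHat FinAdeles ↔ ∀ i j, m i j ∈ zHat := by
  rw [mem_matSubgroup]
  refine forall₂_congr fun i j => ?_
  exact ⟨by rintro ⟨x, hx⟩; exact hx ▸ x.2, fun h => ⟨⟨_, h⟩, rfl⟩⟩

theorem mem_slSubgroup_zHat {g : GL (Fin 2) FinAdeles} :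
    g ∈ slSubgroup zHat FinAdeles ↔ (∀ i j, g.val i j ∈ zHat) ∧ g.val.det = 1 := by
  rw [mem_slSubgroup Subtype.val_injective, mem_matSubgroup_zHat]

theorem slSubgroup_zHat_le_glPosFinAdeles : slSubgroup zHat FinAdeles ≤ glPosFinAdeles :=
  fun _ hg => mem_glPosFinAdeles.2
    ⟨1, one_pos, by rw [map_one, (mem_slSubgroup_zHat.1 hg).2]⟩

theorem isOpen_setOf_forall_mem_zHat :
    IsOpen {g : GL (Fin 2) FinAdeles |
      (∀ i j, g.val i j ∈ zHat) ∧ ∀ i j, g⁻¹.val i j ∈ zHat} := by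
  simp only [Set.ofPred_and, Set.ofPred_forall]
  have h1 (i j : Fin 2) : Continuous fun g : GL (Fin 2) FinAdeles => g.val i j := by fun_prop
  have h2 (i j : Fin 2) : Continuous fun g : GL (Fin 2) FinAdeles => g⁻¹.val i j :=
    (h1 i j).comp continuous_inv
  exact (isOpen_iInter_of_finite fun i => isOpen_iInter_of_finite fun j =>
    isOpen_zHat.preimage (h1 i j)).inter (isOpen_iInter_of_finite fun i =>
      isOpen_iInter_of_finite fun j => isOpen_zHat.preimage (h2 i j))

/-- The determinant of an element of GL₂(Ẑ) is a unit of Ẑ, and a positive rational that is such a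
unit equals 1. Thus SL₂(Ẑ) is open in GL₂⁺(𝔸_f), although it is not open in GL₂(𝔸_f). -/
theorem mem_slSubgroup_zHat_iff_of_mem {g : GL (Fin 2) FinAdeles} (hg : g ∈ glPosFinAdeles) :
    g ∈ slSubgroup zHat FinAdeles ↔
      (∀ i j, g.val i j ∈ zHat) ∧ ∀ i j, g⁻¹.val i j ∈ zHat := by
  constructor
  · exact fun h => ⟨(mem_slSubgroup_zHat.1 h).1, (mem_slSubgroup_zHat.1 (inv_mem h)).1⟩
  · exact fun h => mem_slSubgroup_zHat.2 ⟨h.1, det_eq_one_of_mem_zHat hg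
      (Matrix.det_mem_of_forall_mem h.1) (Matrix.det_mem_of_forall_mem h.2)⟩

/-- The group `ℚ₊^*` is discrete, hence closed, in the idele group. -/
theorem isClosed_map_posSubgroup :
    IsClosed (((Units.posSubgroup ℚ).map (Units.map ratToFinAdeles.toMonoidHom) :
      Subgroup FinAdelesˣ) : Set FinAdelesˣ) := by
  set Γ : Subgroup FinAdelesˣ := (Units.posSubgroup ℚ).map (Units.map ratToFinAdeles.toMonoidHom)
  have hU : IsOpen {u : FinAdelesˣ | u.val ∈ zHat ∧ u⁻¹.val ∈ zHat} :=
    (isOpen_zHat.preimage Units.continuous_val).inter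
      (isOpen_zHat.preimage (Units.continuous_val.comp continuous_inv))
  have : DiscreteTopology Γ := by
    refine discreteTopology_of_isOpen_singleton_one ?_
    convert hU.preimage (continuous_subtype_val (p := (· ∈ Γ)))
    refine Set.Subset.antisymm ?_ ?_
    · rintro _ rfl
      exact ⟨one_mem zHat, by simp⟩
    · rintro ⟨_, q, hq, rfl⟩ ⟨h1, h2⟩
      refine Subtype.ext (Units.ext ?_)
      have h2' : ratToFinAdeles (q.val)⁻¹ ∈ zHat := by
        rw [← Units.val_inv_eq_inv_val]; exact h2
      change ratToFinAdeles q.val = 1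
      rw [eq_one_of_ratToFinAdeles_mem_zHat hq h1 h2', map_one]
  exact Subgroup.isClosed_of_discrete

theorem isClosed_glPosFinAdeles : IsClosed (glPosFinAdeles : Set (GL (Fin 2) FinAdeles)) :=
  isClosed_map_posSubgroup.preimage Matrix.GeneralLinearGroup.continuous_det

/-- The diagonal matrix with entries `q` and `1`. -/
noncomputable def diagRat (q : ℚ) (hq : q ≠ 0) : GL (Fin 2) ℚ :=
  Matrix.GeneralLinearGroup.mkOfDetNeZero !![q, 0; 0, 1] (by simpa [Matrix.det_fin_two])

theorem det_diagRat {q : ℚ} (hq : q ≠ 0) : (diagRat q hq).val.det = q := by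
  change (!![q, 0; 0, 1] : Matrix _ _ ℚ).det = q
  simp [Matrix.det_fin_two]

/-! ### Strong approximation: the closure of GL₂⁺(ℚ) and the product decomposition. -/

open Matrix.GeneralLinearGroup in
theorem closure_image_glPos :
    closure (glRatToFinAdeles '' (Matrix.GLPos (Fin 2) ℚ : Set (GL (Fin 2) ℚ))) =
      (glPosFinAdeles : Set (GL (Fin 2) FinAdeles)) := by
  refine Set.Subset.antisymm (closure_minimal ?_ isClosed_glPosFinAdeles) ?_
  · rintro _ ⟨g, hg, rfl⟩
    exact glRatToFinAdeles_mem_glPosFinAdeles hg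
  set H : Subgroup (GL (Fin 2) FinAdeles) :=
    ((Matrix.GLPos (Fin 2) ℚ).map glRatToFinAdeles).topologicalClosure with hH
  have hmem {g : GL (Fin 2) ℚ} (hg : 0 < g.val.det) : glRatToFinAdeles g ∈ H :=
    Subgroup.le_topologicalClosure _ ⟨g, hg, rfl⟩
  have hclosed : IsClosed (H : Set (GL (Fin 2) FinAdeles)) :=
    Subgroup.isClosed_topologicalClosure _
  have hu (x : FinAdeles) : upperUnipotent x ∈ H := by
    refine denseRange_ratToFinAdeles.induction_on x
      (hclosed.preimage continuous_upperUnipotent) fun q => ?_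
    rw [← map_upperUnipotent]
    exact hmem (g := upperUnipotent q) (by simp [coe_upperUnipotent, Matrix.det_fin_two])
  have hl (x : FinAdeles) : lowerUnipotent x ∈ H := by
    refine denseRange_ratToFinAdeles.induction_on x
      (hclosed.preimage continuous_lowerUnipotent) fun q => ?_
    rw [← map_lowerUnipotent]
    exact hmem (g := lowerUnipotent q) (by simp [coe_lowerUnipotent, Matrix.det_fin_two])
  intro g hg
  change g ∈ H
  obtain ⟨q, hq, hd⟩ := mem_glPosFinAdeles.1 hg
  -- Dividing by diag(q, 1), where q = det g, reduces to determinant 1.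
  have hδ : glRatToFinAdeles (diagRat q hq.ne') ∈ H := hmem (by rwa [det_diagRat])
  refine (H.mul_mem_cancel_left (H.inv_mem hδ)).1 ?_
  have hdet : ((glRatToFinAdeles (diagRat q hq.ne'))⁻¹ * g).val.det = 1 := by
    refine det_inv_mul_eq_one ?_
    rw [det_map_eq, det_diagRat, hd]
  obtain ⟨t, ht⟩ := FinAdeles.exists_isUnit_add_mul ((Matrix.det_fin_two _).symm.trans hdet)
  exact mem_of_isUnit_of_unipotent_mem hu hl hdet ht

theorem glPosFinAdeles_eq_image_mul :
    (glPosFinAdeles : Set (GL (Fin 2) FinAdeles)) =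
      (glRatToFinAdeles '' (Matrix.GLPos (Fin 2) ℚ : Set (GL (Fin 2) ℚ))) *
        (slSubgroup zHat FinAdeles : Set (GL (Fin 2) FinAdeles)) := by
  refine Set.Subset.antisymm (fun g hg => ?_) ?_
  · have hc : Continuous fun x : GL (Fin 2) FinAdeles => x⁻¹ * g :=
      continuous_inv.mul continuous_const
    have h1 (i j : Fin 2) : (1 : Matrix (Fin 2) (Fin 2) FinAdeles) i j ∈ zHat := by
      rw [Matrix.one_apply]
      split_ifs
      exacts [one_mem _, zero_mem _]
    have hcl : g ∈ closure (glRatToFinAdeles '' (Matrix.GLPos (Fin 2) ℚ : Set (GL (Fin 2) ℚ))) := by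
      rwa [closure_image_glPos]
    -- The set of x with x⁻¹ * g in GL₂(Ẑ) is an open neighbourhood of g, so it contains some
    -- rational γ.
    obtain ⟨_, hx, γ, hγ, rfl⟩ := mem_closure_iff.1 hcl _
      (isOpen_setOf_forall_mem_zHat.preimage hc) (by
        rw [Set.mem_preimage, inv_mul_cancel]
        exact ⟨h1, by rw [inv_one]; exact h1⟩)
    refine ⟨_, ⟨γ, hγ, rfl⟩, (glRatToFinAdeles γ)⁻¹ * g, ?_, mul_inv_cancel_left _ _⟩
    exact (mem_slSubgroup_zHat_iff_of_mem (mul_mem (inv_mem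
      (glRatToFinAdeles_mem_glPosFinAdeles hγ)) hg)).2 hx
  · rintro _ ⟨_, ⟨γ, hγ, rfl⟩, k, hk, rfl⟩
    exact mul_mem (glRatToFinAdeles_mem_glPosFinAdeles hγ) (slSubgroup_zHat_le_glPosFinAdeles hk)

/-! ### Hecke pairs from compact open subgroups. -/

section HeckePairs

variable {N M : Type*} [Group N] [Group M]

theorem isReducedPair_iff {N₀ : Subgroup N} :
    IsReducedPair N₀ ↔ ∀ x, (∀ y, y⁻¹ * x * y ∈ N₀) → x = 1 := by
  simp only [IsReducedPair, Subgroup.eq_bot_iff_forall, Subgroup.mem_iInf, Subgroup.mem_map_equiv,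
    MulAut.conj_symm_apply]

/-- This transfers the Hecke condition from the adelic pair to the rational one, so no index over ℤ
is ever computed. -/
theorem IsHeckePair.comap {M₀ : Subgroup M} (h : IsHeckePair M₀) (φ : N →* M) :
    IsHeckePair (M₀.comap φ) := by
  intro x
  have : (M₀.comap φ).map (MulAut.conj x).toMonoidHom =
      (M₀.map (MulAut.conj (φ x)).toMonoidHom).comap φ := by
    ext y
    simp only [Subgroup.mem_map_equiv, Subgroup.mem_comap, MulAut.conj_symm_apply, map_mul, map_inv]
  rw [this]
  exact Subgroup.relIndex_comap_ne_zero φ (h (φ x))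

theorem Subgroup.relIndex_ne_zero_of_isOpen_of_isCompact [TopologicalSpace M]
    [IsTopologicalGroup M] {U K : Subgroup M} (hU : IsOpen (U : Set M))
    (hK : IsCompact (K : Set M)) : U.relIndex K ≠ 0 := by
  have : CompactSpace K := isCompact_iff_compactSpace.1 hK
  have := Subgroup.quotient_finite_of_isOpen (U.subgroupOf K) (hU.preimage continuous_subtype_val)
  exact Subgroup.index_ne_zero_of_finite (H := U.subgroupOf K)

theorem isHeckePair_of_isOpen_of_isCompact [TopologicalSpace M] [IsTopologicalGroup M]
    {M₀ : Subgroup M} (ho : IsOpen (M₀ : Set M)) (hc : IsCompact (M₀ : Set M)) :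
    IsHeckePair M₀ := by
  refine fun x => Subgroup.relIndex_ne_zero_of_isOpen_of_isCompact ?_ hc
  have hcont : Continuous fun y => (MulAut.conj x).symm y := by
    simp only [MulAut.conj_symm_apply]
    fun_prop
  convert ho.preimage hcont using 1
  ext y
  exact Subgroup.mem_map_equiv

end HeckePairs

/-! ### Topology of semidirect products. -/

namespace SemidirectProduct

variable {V G : Type*} [Group V] [Group G] [TopologicalSpace V] [TopologicalSpace G]
  (φ : G →* MulAut V)

/-- The underlying space of a semidirect product is the product space. -/
def homeomorphProd : V ⋊[φ] G ≃ₜ V × G where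
  toEquiv := equivProd
  continuous_toFun := continuous_induced_dom
  continuous_invFun := continuous_induced_rng.2 continuous_id

theorem continuous_left : Continuous (left : V ⋊[φ] G → V) :=
  continuous_fst.comp (homeomorphProd φ).continuous

theorem continuous_right : Continuous (right : V ⋊[φ] G → G) :=
  continuous_snd.comp (homeomorphProd φ).continuous

variable {φ}

theorem isTopologicalGroup [IsTopologicalGroup V] [IsTopologicalGroup G]
    (h : Continuous fun p : G × V => φ p.1 p.2) : IsTopologicalGroup (V ⋊[φ] G) where
  continuous_mul := by
    have hl := continuous_left φ
    have hr := continuous_right φ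
    refine continuous_induced_rng.2 (Continuous.prodMk ?_ ?_)
    · exact (hl.comp continuous_fst).mul
        (h.comp ((hr.comp continuous_fst).prodMk (hl.comp continuous_snd)))
    · exact (hr.comp continuous_fst).mul (hr.comp continuous_snd)
  continuous_inv := by
    have hl := continuous_left φ
    have hr := continuous_right φ
    exact continuous_induced_rng.2 ((h.comp (hr.inv.prodMk hl.inv)).prodMk hr.inv)

theorem isOpen_subgroupOfInvariant {V₀ : Subgroup V} {Γ : Subgroup G}
    (h : ∀ g ∈ Γ, ∀ v ∈ V₀, φ g v ∈ V₀) (hV : IsOpen (V₀ : Set V)) (hΓ : IsOpen (Γ : Set G)) :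
    IsOpen (subgroupOfInvariant φ V₀ Γ h : Set (V ⋊[φ] G)) :=
  (hV.prod hΓ).preimage (homeomorphProd φ).continuous

theorem isCompact_subgroupOfInvariant {V₀ : Subgroup V} {Γ : Subgroup G}
    (h : ∀ g ∈ Γ, ∀ v ∈ V₀, φ g v ∈ V₀) (hV : IsCompact (V₀ : Set V))
    (hΓ : IsCompact (Γ : Set G)) :
    IsCompact (subgroupOfInvariant φ V₀ Γ h : Set (V ⋊[φ] G)) :=
  (homeomorphProd φ).isCompact_preimage.2 (hV.prod hΓ)

instance [T2Space V] [T2Space G] : T2Space (V ⋊[φ] G) :=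
  (homeomorphProd φ).isEmbedding.t2Space

instance [TotallyDisconnectedSpace V] [TotallyDisconnectedSpace G] :
    TotallyDisconnectedSpace (V ⋊[φ] G) :=
  (homeomorphProd φ).symm.totallyDisconnectedSpace

theorem denseRange_of_left_right {W H : Type*} [Group W] [Group H] {ψ : H →* MulAut W}
    {f : W → V} {k : H → G} (hf : DenseRange f) (hk : DenseRange k) {F : W ⋊[ψ] H → V ⋊[φ] G}
    (hl : ∀ x, (F x).left = f x.left) (hr : ∀ x, (F x).right = k x.right) : DenseRange F := by
  have : F = (homeomorphProd φ).symm ∘ Prod.map f k ∘ equivProd :=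
    funext fun x => SemidirectProduct.ext (hl x) (hr x)
  have hd : DenseRange (Prod.map f k ∘ (equivProd : W ⋊[ψ] H ≃ W × H)) := by
    rw [DenseRange, EquivLike.range_comp]
    exact hf.prodMap hk
  rw [this]
  exact (homeomorphProd φ).symm.surjective.denseRange.comp hd (homeomorphProd φ).symm.continuous

theorem left_inv_inl_mul_mul_inl {V G : Type*} [Group V] [Group G] {φ : G →* MulAut V} (v : V)
    (x : V ⋊[φ] G) : ((inl v)⁻¹ * x * inl v).left = v⁻¹ * x.left * φ x.right v := by
  simp [← map_inv]

theorem left_inv_inr_mul_mul_inr {V G : Type*} [Group V] [Group G] {φ : G →* MulAut V} (g : G)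
    (x : V ⋊[φ] G) : ((inr g)⁻¹ * x * inr g).left = φ g⁻¹ x.left := by
  simp [← map_inv]

end SemidirectProduct

/-! ### Topology of the adelic affine group and its compact open subgroup. -/

theorem totallyDisconnectedSpace_of_injective_of_continuous {X Y : Type*} [TopologicalSpace X]
    [TopologicalSpace Y] [TotallyDisconnectedSpace Y] {f : X → Y} (hf : Function.Injective f)
    (hc : Continuous f) : TotallyDisconnectedSpace X :=
  ⟨isTotallyDisconnected_of_image hc.continuousOn hf
    (isTotallyDisconnected_of_totallyDisconnectedSpace _)⟩

instance FinAdeles.totallyDisconnectedSpace : TotallyDisconnectedSpace FinAdeles :=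
  totallyDisconnectedSpace_of_injective_of_continuous DFunLike.coe_injective
    RestrictedProduct.continuous_coe

instance Matrix.totallyDisconnectedSpace {m n R : Type*} [TopologicalSpace R]
    [TotallyDisconnectedSpace R] : TotallyDisconnectedSpace (Matrix m n R) :=
  inferInstanceAs (TotallyDisconnectedSpace (m → n → R))

instance Multiplicative.totallyDisconnectedSpace {X : Type*} [TopologicalSpace X]
    [TotallyDisconnectedSpace X] : TotallyDisconnectedSpace (Multiplicative X) :=
  inferInstanceAs (TotallyDisconnectedSpace X)

instance Units.totallyDisconnectedSpace {X : Type*} [Monoid X] [TopologicalSpace X]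
    [TotallyDisconnectedSpace X] : TotallyDisconnectedSpace Xˣ :=
  totallyDisconnectedSpace_of_injective_of_continuous Units.val_injective Units.continuous_val

theorem continuous_matAction {R : Type*} [CommRing R] [TopologicalSpace R] [IsTopologicalRing R]
    (G : Subgroup (GL (Fin 2) R)) :
    Continuous fun p : G × Multiplicative (Matrix (Fin 2) (Fin 2) R) =>
      ((matAction R).comp G.subtype) p.1 p.2 := by
  have h1 : Continuous fun p : G × Multiplicative (Matrix (Fin 2) (Fin 2) R) =>
      ((p.1 : GL (Fin 2) R)⁻¹).val :=
    Units.continuous_val.comp (continuous_subtype_val.comp continuous_fst).inv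
  have h2 : Continuous fun p : G × Multiplicative (Matrix (Fin 2) (Fin 2) R) => p.2.toAdd :=
    continuous_toAdd.comp continuous_snd
  exact continuous_ofAdd.comp (h2.matrix_mul h1)

instance AffineMatGroup.isTopologicalGroup {R : Type*} [CommRing R] [TopologicalSpace R]
    [IsTopologicalRing R] (G : Subgroup (GL (Fin 2) R)) :
    IsTopologicalGroup (AffineMatGroup R G) :=
  SemidirectProduct.isTopologicalGroup (continuous_matAction G)

theorem coe_matSubgroup_zHat :
    (matSubgroup zHat FinAdeles : Set (Matrix (Fin 2) (Fin 2) FinAdeles)) =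
    Set.univ.pi fun _ => Set.univ.pi fun _ => zHat := by
  ext m
  exact mem_matSubgroup_zHat.trans
    ⟨fun h i _ j _ => h i j, fun h i j => h i trivial j trivial⟩

theorem isCompact_matSubgroup_zHat :
    IsCompact (matSubgroup zHat FinAdeles : Set (Matrix (Fin 2) (Fin 2) FinAdeles)) := by
  rw [coe_matSubgroup_zHat]
  exact isCompact_univ_pi fun _ => isCompact_univ_pi fun _ => isCompact_zHat

theorem isOpen_matSubgroup_zHat :
    IsOpen (matSubgroup zHat FinAdeles : Set (Matrix (Fin 2) (Fin 2) FinAdeles)) := by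
  rw [coe_matSubgroup_zHat]
  exact isOpen_set_pi Set.finite_univ fun _ _ => isOpen_set_pi Set.finite_univ fun _ _ => isOpen_zHat

/-- SL₂(𝔸_f) is closed in M₂(𝔸_f), so its intersection with the compact M₂(Ẑ) is compact; the map to
GL₂ is continuous. -/
theorem isCompact_slSubgroup_zHat :
    IsCompact (slSubgroup zHat FinAdeles : Set (GL (Fin 2) FinAdeles)) := by
  have : (slSubgroup zHat FinAdeles : Set (GL (Fin 2) FinAdeles)) =
      Matrix.SpecialLinearGroup.toGL '' ((fun s : Matrix.SpecialLinearGroup (Fin 2) FinAdeles =>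
        s.val) ⁻¹' (matSubgroup zHat FinAdeles : Set (Matrix (Fin 2) (Fin 2) FinAdeles))) := by
    ext g
    rw [SetLike.mem_coe, mem_slSubgroup Subtype.val_injective]
    constructor
    · exact fun h => ⟨⟨g.val, h.2⟩, h.1, Units.ext rfl⟩
    · rintro ⟨s, hs, rfl⟩
      exact ⟨hs, s.2⟩
  rw [this]
  exact (Matrix.SpecialLinearGroup.isClosedEmbedding_val.isCompact_preimage
    isCompact_matSubgroup_zHat).image Matrix.SpecialLinearGroup.continuous_toGL

theorem isOpen_affineSubgroup_zHat :
    IsOpen (affineSubgroup zHat FinAdeles glPosFinAdeles :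
      Set (AffineMatGroup FinAdeles glPosFinAdeles)) := by
  refine SemidirectProduct.isOpen_subgroupOfInvariant _
    (isOpen_matSubgroup_zHat.preimage continuous_toAdd) ?_
  convert isOpen_setOf_forall_mem_zHat.preimage
    (continuous_subtype_val (p := (· ∈ glPosFinAdeles)))
  ext g
  exact mem_slSubgroup_zHat_iff_of_mem g.2

theorem isCompact_affineSubgroup_zHat :
    IsCompact (affineSubgroup zHat FinAdeles glPosFinAdeles :
      Set (AffineMatGroup FinAdeles glPosFinAdeles)) := by
  refine SemidirectProduct.isCompact_subgroupOfInvariant _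
    isCompact_matSubgroup_zHat ?_
  -- Compactness passes to the subspace GL₂⁺(𝔸_f) because that subspace is closed.
  exact isClosed_glPosFinAdeles.isClosedEmbedding_subtypeVal.isCompact_preimage
    isCompact_slSubgroup_zHat

/-- The scalar matrix with entry `q`. -/
noncomputable def scalarRat (q : ℚ) (hq : q ≠ 0) : GL (Fin 2) ℚ :=
  Matrix.GeneralLinearGroup.mkOfDetNeZero (q • 1) (by simpa [Matrix.det_smul])

/-! ### The axioms of a Schlichting completion. -/

/-- Let (m, g) lie in every conjugate. Conjugating by translations v puts v * (g⁻¹ - 1) in M₂(Ẑ);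
scalar v = q for all rational q force g = 1. Conjugating by scalar matrices q puts q * m in M₂(Ẑ),
which forces m = 0. -/
theorem isReducedPair_affineSubgroup_zHat :
    IsReducedPair (affineSubgroup zHat FinAdeles glPosFinAdeles) := by
  rw [isReducedPair_iff]
  intro x hx
  have hleft (y) : (y⁻¹ * x * y).left.toAdd ∈ matSubgroup zHat FinAdeles := (hx y).1
  have hm := hleft 1
  rw [inv_one, one_mul, mul_one] at hm
  have hright : x.right = 1 := by
    have key (v : Matrix (Fin 2) (Fin 2) FinAdeles) :
        v * (((x.right⁻¹ : glPosFinAdeles) : GL (Fin 2) FinAdeles).val - 1) ∈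
          matSubgroup zHat FinAdeles := by
      have h1 := sub_mem (hleft (SemidirectProduct.inl (.ofAdd v))) hm
      rw [SemidirectProduct.left_inv_inl_mul_mul_inl] at h1
      convert h1 using 1
      change v * (((x.right : GL (Fin 2) FinAdeles)⁻¹).val - 1) =
        -v + x.left.toAdd + v * ((x.right : GL (Fin 2) FinAdeles)⁻¹).val - x.left.toAdd
      rw [mul_sub, mul_one]
      abel
    rw [← inv_eq_one]
    refine Subtype.ext (Units.ext (sub_eq_zero.1 (Matrix.ext fun i j => ?_)))
    refine FinAdeles.eq_zero_of_forall_mul_mem_zHat fun q => ?_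
    have := mem_matSubgroup_zHat.1 (key (ratToFinAdeles q • 1)) i j
    rwa [Matrix.smul_mul, one_mul] at this
  refine SemidirectProduct.ext ?_ hright
  refine congrArg Multiplicative.ofAdd (?_ : x.left.toAdd = 0)
  refine Matrix.ext fun i j => ?_
  refine FinAdeles.eq_zero_of_forall_mul_mem_zHat fun q => ?_
  by_cases hq : q = 0
  · rw [hq, map_zero, zero_mul]
    exact zero_mem _
  -- The determinant is q², so negative q are allowed as well.
  have hpos : scalarRat q hq ∈ Matrix.GLPos (Fin 2) ℚ := by
    change 0 < (q • 1 : Matrix (Fin 2) (Fin 2) ℚ).det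
    rw [Matrix.det_smul, Matrix.det_one, mul_one, Fintype.card_fin]
    positivity
  let h : glPosFinAdeles := ⟨_, glRatToFinAdeles_mem_glPosFinAdeles hpos⟩
  have h1 := mem_matSubgroup_zHat.1 (hleft (SemidirectProduct.inr h)) i j
  rw [SemidirectProduct.left_inv_inr_mul_mul_inr] at h1
  change (x.left.toAdd * ((h⁻¹ : glPosFinAdeles)⁻¹ : GL (Fin 2) FinAdeles).val) i j ∈ zHat at h1
  rw [InvMemClass.coe_inv, inv_inv] at h1
  have hval : (h : GL (Fin 2) FinAdeles).val = ratToFinAdeles q • 1 := by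
    change ratToFinAdeles.mapMatrix (q • 1) = _
    rw [RingHom.mapMatrix_apply, Matrix.map_smul' _ _ _ (map_mul ratToFinAdeles),
      Matrix.map_one _ (map_zero _) (map_one _)]
  rwa [hval, Matrix.mul_smul, mul_one] at h1

theorem denseRange_affineMap :
    DenseRange (affineMap ratToFinAdeles (Matrix.GLPos (Fin 2) ℚ) glPosFinAdeles
      glPos_le_comap) := by
  refine SemidirectProduct.denseRange_of_left_right
    (f := fun m => .ofAdd (m.toAdd.map ratToFinAdeles))
    (k := fun g => ⟨_, glRatToFinAdeles_mem_glPosFinAdeles g.2⟩) ?_ ?_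
    (fun _ => rfl) (fun _ => rfl)
  · have h := DenseRange.piMap (fun _ : Fin 2 =>
      DenseRange.piMap (fun _ : Fin 2 => denseRange_ratToFinAdeles))
    exact h
  · rintro ⟨g, hg⟩
    have hcl : g ∈ closure (glRatToFinAdeles '' (Matrix.GLPos (Fin 2) ℚ : Set (GL (Fin 2) ℚ))) := by
      rwa [closure_image_glPos]
    -- Density inside GL₂⁺(𝔸_f) is read off from the closure taken in GL₂(𝔸_f).
    rw [closure_subtype]
    convert hcl using 2
    ext x
    constructor
    · rintro ⟨_, ⟨γ, rfl⟩, rfl⟩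
      exact ⟨γ, γ.2, rfl⟩
    · rintro ⟨γ, hγ, rfl⟩
      exact ⟨_, ⟨⟨γ, hγ⟩, rfl⟩, rfl⟩

/-- Both factors reduce entrywise to ℚ ∩ Ẑ = ℤ; injectivity of ℚ → 𝔸_f handles the condition det =
1. -/
theorem comap_affineSubgroup_zHat :
    (affineSubgroup zHat FinAdeles glPosFinAdeles).comap
      (affineMap ratToFinAdeles (Matrix.GLPos (Fin 2) ℚ) glPosFinAdeles glPos_le_comap) =
    affineSubgroup ℤ ℚ (Matrix.GLPos (Fin 2) ℚ) := by
  have hmat (m : Matrix (Fin 2) (Fin 2) ℚ) :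
      ratToFinAdeles.mapMatrix m ∈ matSubgroup zHat FinAdeles ↔ m ∈ matSubgroup ℤ ℚ := by
    rw [mem_matSubgroup_zHat, mem_matSubgroup]
    exact forall₂_congr fun i j => ratToFinAdeles_mem_zHat
  have hsl (g : GL (Fin 2) ℚ) :
      glRatToFinAdeles g ∈ slSubgroup zHat FinAdeles ↔ g ∈ slSubgroup ℤ ℚ := by
    rw [mem_slSubgroup Subtype.val_injective, mem_slSubgroup (algebraMap ℤ ℚ).injective_int,
      Matrix.GeneralLinearGroup.det_map_eq, map_eq_one_iff _ ratToFinAdeles_injective]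
    exact and_congr_left' (hmat g.val)
  ext x
  exact and_congr (hmat x.left.toAdd) (hsl x.right)

theorem isSchlichtingCompletion_affineMap :
    IsSchlichtingCompletion
      (affineSubgroup ℤ ℚ (Matrix.GLPos (Fin 2) ℚ))
      (affineSubgroup zHat FinAdeles glPosFinAdeles)
      (affineMap ratToFinAdeles (Matrix.GLPos (Fin 2) ℚ) glPosFinAdeles glPos_le_comap) where
  isHeckePair := by
    rw [← comap_affineSubgroup_zHat]
    exact (isHeckePair_of_isOpen_of_isCompact isOpen_affineSubgroup_zHat
      isCompact_affineSubgroup_zHat).comap _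
  isTopologicalGroup := inferInstance
  t2Space := inferInstance
  locallyCompactSpace := isCompact_affineSubgroup_zHat.locallyCompactSpace_of_mem_nhds_of_group
    (isOpen_affineSubgroup_zHat.mem_nhds (one_mem _))
  totallyDisconnectedSpace := inferInstance
  isCompact := isCompact_affineSubgroup_zHat
  isOpen := isOpen_affineSubgroup_zHat
  isHeckePair_completion := isHeckePair_of_isOpen_of_isCompact isOpen_affineSubgroup_zHat
    isCompact_affineSubgroup_zHat
  isReducedPair := isReducedPair_affineSubgroup_zHat
  denseRange := denseRange_affineMap
  comap_eq := comap_affineSubgroup_zHat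

theorem proposition2 :
    closure (glRatToFinAdeles '' (Matrix.GLPos (Fin 2) ℚ : Set (GL (Fin 2) ℚ))) =
        (glPosFinAdeles : Set (GL (Fin 2) FinAdeles)) ∧
      (glPosFinAdeles : Set (GL (Fin 2) FinAdeles)) =
        (glRatToFinAdeles '' (Matrix.GLPos (Fin 2) ℚ : Set (GL (Fin 2) ℚ))) *
          (slSubgroup zHat FinAdeles : Set (GL (Fin 2) FinAdeles)) ∧
      IsSchlichtingCompletion
        (affineSubgroup ℤ ℚ (Matrix.GLPos (Fin 2) ℚ))
        (affineSubgroup zHat FinAdeles glPosFinAdeles)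
        (affineMap ratToFinAdeles (Matrix.GLPos (Fin 2) ℚ) glPosFinAdeles glPos_le_comap) :=
  ⟨closure_image_glPos, glPosFinAdeles_eq_image_mul, isSchlichtingCompletion_affineMap⟩
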